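/- Let $G$ be a finite simple graph whose vertex set is partitioned into a set $V_B$ of breakable vertices and a set $V_U$ of unbreakable vertices. Breaking a vertex $v$ of degree $k$ means replacing $v$ by $k$ new vertices of degree $1$, one attached to each of the $k$ edges that were incident with $v$. For sets $B, U \subseteq \mathbb{N}$, an input of Planar Graph $(B,U)$-TRVB (Tree-Residue Vertex-Breaking) is such a graph $G$ that is planar, with $\deg(v) \in B$ for every $v \in V_B$ and $\deg(v) \in U$ for every $v \in V_U$; it is a "yes" instance if there is a set $S \subseteq V_B$ such that breaking every vertex of $S$ in $G$ yields a tree, and a "no" instance otherwise. **Theorem.** Suppose that $b > 5$ for every $b \in B$ and $u > 4$ for every $u \in U$. Then every input of Planar Graph $(B,U)$-TRVB is a "no" instance, and Planar Graph $(B,U)$-TRVB can be solved in polynomial time: the language of all binary strings that encode a "yes" instance (by its number of vertices, its breakable/unbreakable labels and its adjacency matrix) is decided by a Turing machine whose running time is polynomial in the length of the string. -/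

import Mathlib

/-! ### Planar graphs -/

/-- `A` is a polygonal arc in the plane with endpoints `a` and `b`: it is traced by an injective
path `γ` on `[0, n]` that runs along a straight line segment on each `[i, i + 1]`. -/
def IsPolygonalArc (A : Set (ℝ × ℝ)) (a b : ℝ × ℝ) : Prop :=
  ∃ (n : ℕ) (γ : ℝ → ℝ × ℝ),
    (∀ i < n, ∀ t ∈ Set.Icc (0 : ℝ) 1,
      γ (i + t) = AffineMap.lineMap (γ i) (γ (i + 1)) t) ∧
    Set.InjOn γ (Set.Icc 0 n) ∧ γ 0 = a ∧ γ n = b ∧ γ '' Set.Icc 0 n = A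

/-- A graph is planar if it can be drawn in the plane without crossings: vertices are distinct
points, every edge is an arc joining its two ends, an arc contains no vertex other than its ends,
and two different arcs meet at most in common ends. As usual for finite graphs, arcs are
polygonal. -/
def SimpleGraph.IsPlanar {V : Type*} (G : SimpleGraph V) : Prop :=
  ∃ (p : V → ℝ × ℝ) (arc : Sym2 V → Set (ℝ × ℝ)),
    Function.Injective p ∧
    (∀ u v, G.Adj u v → IsPolygonalArc (arc s(u, v)) (p u) (p v)) ∧
    (∀ e ∈ G.edgeSet, ∀ w, p w ∈ arc e → w ∈ e) ∧
    (∀ e ∈ G.edgeSet, ∀ f ∈ G.edgeSet, e ≠ f →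
      ∀ x ∈ arc e ∩ arc f, ∃ w, w ∈ e ∧ w ∈ f ∧ p w = x)

/-! ### Breaking vertices -/

/-- Vertices of the graph obtained by breaking every vertex of `S`: the vertices outside `S`, and
for every `v ∈ S` one new vertex for each edge at `v` (a dart of `G` starting at `v`). -/
abbrev SimpleGraph.BrokenVertex {V : Type*} (G : SimpleGraph V) (S : Set V) : Type _ :=
  {v : V // v ∉ S} ⊕ {d : G.Dart // d.fst ∈ S}

open Classical in
/-- After breaking `S`, the vertex to which the starting end of the edge `d` is attached: the
original vertex if it is not broken, and otherwise the new vertex made for this edge. -/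
noncomputable def SimpleGraph.brokenEnd {V : Type*} (G : SimpleGraph V) (S : Set V) (d : G.Dart) :
    G.BrokenVertex S :=
  if h : d.fst ∈ S then Sum.inr ⟨d, h⟩ else Sum.inl ⟨d.fst, h⟩

theorem SimpleGraph.brokenEnd_symm_ne {V : Type*} (G : SimpleGraph V) (S : Set V) (d : G.Dart) :
    G.brokenEnd S d ≠ G.brokenEnd S d.symm := by
  intro h
  unfold SimpleGraph.brokenEnd at h
  split_ifs at h
  · simp only [Sum.inr.injEq, Subtype.mk.injEq] at h
    exact d.symm_ne h.symm
  · simp only [Sum.inl.injEq, Subtype.mk.injEq] at h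
    exact d.fst_ne_snd h

/-- The graph obtained from `G` by breaking every vertex of `S`. Each edge of `G` gives exactly one
edge, whose two ends are attached as described by `brokenEnd`. -/
def SimpleGraph.breakVertices {V : Type*} (G : SimpleGraph V) (S : Set V) :
    SimpleGraph (G.BrokenVertex S) where
  Adj x y := ∃ d : G.Dart, G.brokenEnd S d = x ∧ G.brokenEnd S d.symm = y
  symm := ⟨by
    rintro x y ⟨d, hx, hy⟩
    exact ⟨d.symm, hy, by rwa [SimpleGraph.Dart.symm_symm]⟩⟩
  loopless := ⟨by
    rintro x ⟨d, hx, hy⟩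
    exact G.brokenEnd_symm_ne S d (hx.trans hy.symm)⟩

/-! ### The problem Planar Graph `(B, U)`-TRVB -/

/-- A simple graph some of whose vertices are marked as breakable; the others are unbreakable. -/
structure MarkedGraph (V : Type*) where
  graph : SimpleGraph V
  breakable : Set V

/-- The inputs of Planar Graph `(B, U)`-TRVB: planar simple graphs whose breakable vertices have
degrees in `B` and whose unbreakable vertices have degrees in `U`. -/
def MarkedGraph.IsPlanarGraphInput {V : Type*} (I : MarkedGraph V) (B U : Set ℕ) : Prop :=
  I.graph.IsPlanar ∧
  (∀ v ∈ I.breakable, (I.graph.neighborSet v).ncard ∈ B) ∧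
  (∀ v ∉ I.breakable, (I.graph.neighborSet v).ncard ∈ U)

/-- The question of TRVB: can a set of breakable vertices be broken so that a tree results? -/
def MarkedGraph.HasTreeResidue {V : Type*} (I : MarkedGraph V) : Prop :=
  ∃ S ⊆ I.breakable, (I.graph.breakVertices S).IsTree

open Classical in
/-- Bit string of a marked graph on `{0, …, n - 1}`: the number `n` in unary, terminated by a zero,
then the `n` marks, then the `n` rows of the adjacency matrix. -/
noncomputable def MarkedGraph.encode {n : ℕ} (I : MarkedGraph (Fin n)) : List Bool :=
  List.replicate n true ++ [false] ++
  (List.ofFn fun i => decide (i ∈ I.breakable)) ++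
  ((List.finRange n).flatMap fun i => List.ofFn fun j => decide (I.graph.Adj i j))

/-- Planar Graph `(B, U)`-TRVB as a language: the bit strings that encode a "yes" instance. -/
def planarGraphTRVB (B U : Set ℕ) : Language Bool :=
  {w | ∃ (n : ℕ) (I : MarkedGraph (Fin n)),
    I.encode = w ∧ I.IsPlanarGraphInput B U ∧ I.HasTreeResidue}

open Classical in
/-- A language can be decided in polynomial time: some Turing machine, started on an arbitrary bit
string `w`, halts within a number of steps polynomial in the length of `w` and outputs the bit that
tells whether `w ∈ L`. -/
def Language.InP (L : Language Bool) : Prop :=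
  Nonempty (Turing.TM2ComputableInPolyTime (id : List Bool → List Bool) Computability.encodeBool
    (fun w => decide (w ∈ L)))

/-! Suppose that breaking `S` gives a tree. A connected result forces `S` to be independent, so the
number `D` of darts starting in `S` is at most the number of edges of the bipartite graph `H`
between `S` and its complement. Write `s`, `u` for the sizes of `S` and its complement, and `D'` for
the number of darts starting outside `S`. Breaking keeps the edges, of which there are `(D + D') /
2`, and leaves `u + D` vertices, so the tree equation reads `D' + 2 = 2u + D`. A bipartite planar
graph like `H` has at most twice as many edges as vertices, whence `D ≤ 2(s + u)`. With `6s ≤ D`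
this gives `D ≤ 3u`, so `D' + 2 ≤ 5u`, against `5u ≤ D'`. Thus there are no "yes" instances, the
language is empty, and a machine that always rejects decides it.

The work lies in the planar bound, `SimpleGraph.IsPlanar.card_edgeSet_le`. Neither the Jordan curve
theorem nor faces as regions are used. Faces are classes of darts under "turn to the next dart about
the start, then reverse", and all that is needed is that every cycle mod 2 is the boundary of a
function on faces (`PolygonalDrawing.exists_next`). That function counts, mod 2, the cycle edges
above a point just to the left of a dart; `NonCrossing.parity_edge` shows that the count does not
change along a segment. Hence the cycle space has at most `2 ^ F` elements, and `E ≤ V + F`. In the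
bipartite graph every face has at least four darts, so `4F ≤ 2E` and `E ≤ 2V`. -/

/-! ### Cyclic order about a point -/

/-- Cyclic successor in every fibre of a map `start`, where the fibres are ordered by `key`. -/
theorem exists_cyclic_next {D X K : Type*} [Fintype D] [DecidableEq X] [LinearOrder K]
    (start : D → X) (key : D → K)
    (hkey : ∀ d e, start d = start e → key d = key e → d = e) :
    ∃ next : D → D, (∀ d, start (next d) = start d) ∧
      (∀ d e, e ≠ d → start e = start d → next d ≠ d) ∧
      ∀ w : D → ZMod 2, (∀ x, ∑ d, (if start d = x then w d else 0) = 0) → ∀ d,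
        ∑ e, (if start e = start d ∧ key d < key e then w e else 0) =
          ∑ e, (if start e = start d ∧ key (next d) ≤ key e then w e else 0) := by
  classical
  have main : ∀ d, ∃ n, start n = start d ∧ (∀ e, e ≠ d → start e = start d → n ≠ d) ∧
      ((∀ e, start e = start d → (key d < key e ↔ key n ≤ key e)) ∨
        ((∀ e, start e = start d → ¬ key d < key e) ∧
          (∀ e, start e = start d → key n ≤ key e))) := by
    intro d
    by_cases h : ∃ e, start e = start d ∧ key d < key e
    · obtain ⟨n, hn, hmin⟩ := Finset.exists_min_image
        (Finset.univ.filter fun e => start e = start d ∧ key d < key e) key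
        (by obtain ⟨e, he⟩ := h; exact ⟨e, by simpa using he⟩)
      simp only [Finset.mem_filter, Finset.mem_univ, true_and] at hn hmin
      refine ⟨n, hn.1, ?_, Or.inl ?_⟩
      · rintro e - - rfl
        exact lt_irrefl _ hn.2
      · exact fun e he => ⟨fun hlt => hmin e ⟨he, hlt⟩, fun hle => hn.2.trans_le hle⟩
    · push Not at h
      obtain ⟨n, hn, hmin⟩ := Finset.exists_min_image
        (Finset.univ.filter fun e => start e = start d) key ⟨d, by simp⟩
      simp only [Finset.mem_filter, Finset.mem_univ, true_and] at hn hmin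
      refine ⟨n, hn, ?_, Or.inr ⟨fun e he => not_lt.2 (h e he), hmin⟩⟩
      rintro e hne he rfl
      exact hne (hkey e n he (le_antisymm (h e he) (hmin e he)))
  choose next h1 h2 h3 using main
  refine ⟨next, h1, h2, fun w hw d => ?_⟩
  rcases h3 d with h | ⟨h, h'⟩
  · refine Finset.sum_congr rfl fun e _ => ?_
    by_cases he : start e = start d
    · simp only [he, true_and, h e he]
    · simp [he]
  -- Wrap-around from the largest key to the smallest: the left sum is empty, the right one runs
  -- over the whole fibre and vanishes by `hw`.
  · refine (Finset.sum_eq_zero fun e _ => ?_).trans ((hw (start d)).symm.trans ?_)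
    · rw [if_neg]
      rintro ⟨he, hlt⟩
      exact h e he hlt
    · refine Finset.sum_congr rfl fun e _ => ?_
      by_cases he : start e = start d
      · simp [he, h' e he]
      · simp [he]

/-! ### Non-crossing segments as chords of the graph of a function -/

/-- Slope of the segment over `[l, r]` whose ends lie on the graph of `y`. -/
noncomputable def chordSlope (y : ℝ → ℝ) (l r : ℝ) : ℝ := (y r - y l) / (r - l)

/-- Height over `x` of the line through the points over `l` and `r` on the graph of `y`. -/
noncomputable def chordHeight (y : ℝ → ℝ) (l r x : ℝ) : ℝ := y l + chordSlope y l r * (x - l)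

theorem chordHeight_left (y : ℝ → ℝ) (l r : ℝ) : chordHeight y l r l = y l := by
  simp [chordHeight]

theorem chordHeight_right (y : ℝ → ℝ) {l r : ℝ} (h : l < r) : chordHeight y l r r = y r := by
  have : r - l ≠ 0 := (sub_pos.2 h).ne'
  simp only [chordHeight, chordSlope]
  field_simp
  ring

theorem chordHeight_sub (y : ℝ → ℝ) (l r x z : ℝ) :
    chordHeight y l r x = chordHeight y l r z + chordSlope y l r * (x - z) := by
  simp only [chordHeight]
  ring

/-- An affine function without zeros in an open interval does not change sign on its closure. -/
theorem pos_of_pos_of_affine {f : ℝ → ℝ} {k a b x z : ℝ} (hf : ∀ s t, f s = f t + k * (s - t))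
    (h0 : ∀ t, a < t → t < b → f t ≠ 0) (hx : a ≤ x) (hx' : x ≤ b) (hz : a < z) (hz' : z < b)
    (hpos : 0 < f x) : 0 < f z := by
  by_contra hneg
  have hz0 : f z < 0 := lt_of_le_of_ne (not_lt.1 hneg) (h0 z hz hz')
  have hd : 0 < f x - f z := by linarith
  -- The affine function has its zero at this fraction of the way from `x` to `z`.
  set s := f x / (f x - f z) with hs
  have hs0 : 0 < s := div_pos hpos hd
  have hs1 : s < 1 := by rw [hs, div_lt_one hd]; linarith
  have hzero : f (x + s * (z - x)) = 0 := by
    have h1 := hf (x + s * (z - x)) x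
    have h2 := hf z x
    have h3 : s * (f x - f z) = f x := div_mul_cancel₀ _ hd.ne'
    linear_combination h1 - s * h2 - h3
  refine h0 _ ?_ ?_ hzero <;> nlinarith [mul_pos hs0 (sub_pos.2 hz), mul_pos hs0 (sub_pos.2 hz')]

section Segments

variable {ι : Type*} (y : ℝ → ℝ) (l r : ι → ℝ)

/-- Segments with ends on the graph of `y` that meet at most in common ends. -/
structure NonCrossing : Prop where
  lt : ∀ i, l i < r i
  meet : ∀ i j, i ≠ j → ∀ x, l i ≤ x → x ≤ r i → l j ≤ x → x ≤ r j →
    chordHeight y (l i) (r i) x = chordHeight y (l j) (r j) x →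
      (x = l i ∨ x = r i) ∧ (x = l j ∨ x = r j)

/-- Segment `j` lies above segment `i`, judged in the middle of the interval they share. -/
def ChordAbove (i j : ι) : Prop :=
  max (l i) (l j) < min (r i) (r j) ∧
    0 < chordHeight y (l j) (r j) ((max (l i) (l j) + min (r i) (r j)) / 2) -
      chordHeight y (l i) (r i) ((max (l i) (l j) + min (r i) (r j)) / 2)

variable {y l r}

theorem NonCrossing.diff_ne_zero (h : NonCrossing y l r) {i j : ι} (hij : i ≠ j) {x : ℝ}
    (h1 : max (l i) (l j) ≤ x) (h2 : x ≤ min (r i) (r j))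
    (h3 : (l i < x ∧ x < r i) ∨ (l j < x ∧ x < r j)) :
    chordHeight y (l j) (r j) x - chordHeight y (l i) (r i) x ≠ 0 := by
  intro h0
  have := h.meet i j hij x ((le_max_left _ _).trans h1) (h2.trans (min_le_left _ _))
    ((le_max_right _ _).trans h1) (h2.trans (min_le_right _ _)) (by linarith)
  rcases h3 with h3 | h3
  · rcases this.1 with e | e <;> linarith
  · rcases this.2 with e | e <;> linarith

/-- The height difference is affine and has no zero inside the shared interval, so its sign there is
constant. It may be read off at an end too, if that end is interior to one of the two segments. -/
theorem NonCrossing.chordAbove_iff (h : NonCrossing y l r) {i j : ι} (hij : i ≠ j) {x : ℝ}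
    (hlt : max (l i) (l j) < min (r i) (r j))
    (h1 : max (l i) (l j) ≤ x) (h2 : x ≤ min (r i) (r j))
    (h3 : (l i < x ∧ x < r i) ∨ (l j < x ∧ x < r j)) :
    ChordAbove y l r i j ↔
      chordHeight y (l i) (r i) x < chordHeight y (l j) (r j) x := by
  set f : ℝ → ℝ := fun x => chordHeight y (l j) (r j) x - chordHeight y (l i) (r i) x with hf
  have hfa : ∀ s t, f s = f t + (chordSlope y (l j) (r j) - chordSlope y (l i) (r i)) * (s - t) := by
    intro s t
    simp only [hf]
    rw [chordHeight_sub y (l j) (r j) s t, chordHeight_sub y (l i) (r i) s t]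
    ring
  have hf0 : ∀ t, max (l i) (l j) < t → t < min (r i) (r j) → f t ≠ 0 := fun t ht ht' =>
    h.diff_ne_zero hij ht.le ht'.le (Or.inl ⟨(le_max_left _ _).trans_lt ht,
      ht'.trans_le (min_le_left _ _)⟩)
  have hm1 : max (l i) (l j) < (max (l i) (l j) + min (r i) (r j)) / 2 := by linarith
  have hm2 : (max (l i) (l j) + min (r i) (r j)) / 2 < min (r i) (r j) := by linarith
  have hx0 : f x ≠ 0 := h.diff_ne_zero hij h1 h2 h3
  have hiff : ChordAbove y l r i j ↔ 0 < f ((max (l i) (l j) + min (r i) (r j)) / 2) :=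
    ⟨fun h => h.2, fun h => ⟨hlt, h⟩⟩
  rw [hiff, ← sub_pos (b := chordHeight y (l i) (r i) x)]
  change _ ↔ 0 < f x
  refine ⟨fun hpos => ?_, fun hpos => pos_of_pos_of_affine hfa hf0 h1 h2 hm1 hm2 hpos⟩
  by_contra hneg
  have hneg' : 0 < -f x := by
    rcases lt_or_gt_of_ne hx0 with h | h
    · linarith
    · exact absurd h hneg
  have := pos_of_pos_of_affine (f := fun x => -f x)
    (k := -(chordSlope y (l j) (r j) - chordSlope y (l i) (r i)))
    (fun s t => by simp only [hfa s t]; ring) (fun t ht ht' => neg_ne_zero.2 (hf0 t ht ht'))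
    h1 h2 hm1 hm2 hneg'
  linarith

/-- This and the next five equivalences turn each condition counted in `NonCrossing.parity_edge`
into the single relation `ChordAbove` plus a comparison of ends. -/
theorem NonCrossing.above_left_iff (h : NonCrossing y l r) (i j : ι) :
    (l j < l i ∧ l i < r j ∧ y (l i) < chordHeight y (l j) (r j) (l i)) ↔
      (ChordAbove y l r i j ∧ l j < l i) := by
  rcases eq_or_ne i j with rfl | hij
  · simp
  have hi := h.lt i
  have key : l j < l i → l i < r j → (ChordAbove y l r i j ↔
      y (l i) < chordHeight y (l j) (r j) (l i)) := by
    intro h1 h2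
    rw [h.chordAbove_iff hij (x := l i) (by simp [*, h.lt j, h1.trans hi]) (by simp [*, h1.le])
      (by simp [hi.le, h2.le]) (Or.inr ⟨h1, h2⟩), chordHeight_left]
  constructor
  · rintro ⟨h1, h2, h3⟩
    exact ⟨(key h1 h2).2 h3, h1⟩
  · rintro ⟨h1, h2⟩
    have h3 : l i < r j := (le_max_left _ _).trans_lt (h1.1.trans_le (min_le_right _ _))
    exact ⟨h2, h3, (key h2 h3).1 h1⟩

theorem NonCrossing.above_right_iff (h : NonCrossing y l r) (i j : ι) :
    (l j < r i ∧ r i < r j ∧ y (r i) < chordHeight y (l j) (r j) (r i)) ↔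
      (ChordAbove y l r i j ∧ r i < r j) := by
  rcases eq_or_ne i j with rfl | hij
  · simp
  have hi := h.lt i
  have key : l j < r i → r i < r j → (ChordAbove y l r i j ↔
      y (r i) < chordHeight y (l j) (r j) (r i)) := by
    intro h1 h2
    rw [h.chordAbove_iff hij (x := r i) (by simp [*, h.lt j, hi.trans h2]) (by simp [hi.le, h1.le])
      (by simp [h2.le]) (Or.inr ⟨h1, h2⟩), chordHeight_right y hi]
  constructor
  · rintro ⟨h1, h2, h3⟩
    exact ⟨(key h1 h2).2 h3, h2⟩
  · rintro ⟨h1, h2⟩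
    have h3 : l j < r i := (le_max_right _ _).trans_lt (h1.1.trans_le (min_le_left _ _))
    exact ⟨h3, h2, (key h3 h2).1 h1⟩

theorem NonCrossing.left_above_iff (h : NonCrossing y l r) (i j : ι) :
    (l i < l j ∧ l j < r i ∧ chordHeight y (l i) (r i) (l j) < y (l j)) ↔
      (ChordAbove y l r i j ∧ l i < l j) := by
  rcases eq_or_ne i j with rfl | hij
  · simp
  have hj := h.lt j
  have key : l i < l j → l j < r i → (ChordAbove y l r i j ↔
      chordHeight y (l i) (r i) (l j) < y (l j)) := by
    intro h1 h2
    rw [h.chordAbove_iff hij (x := l j) (by simp [*, h.lt i, h1.trans hj]) (by simp [*, h1.le])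
      (by simp [hj.le, h2.le]) (Or.inl ⟨h1, h2⟩), chordHeight_left]
  constructor
  · rintro ⟨h1, h2, h3⟩
    exact ⟨(key h1 h2).2 h3, h1⟩
  · rintro ⟨h1, h2⟩
    have h3 : l j < r i := (le_max_right _ _).trans_lt (h1.1.trans_le (min_le_left _ _))
    exact ⟨h2, h3, (key h2 h3).1 h1⟩

theorem NonCrossing.right_above_iff (h : NonCrossing y l r) (i j : ι) :
    (l i < r j ∧ r j < r i ∧ chordHeight y (l i) (r i) (r j) < y (r j)) ↔
      (ChordAbove y l r i j ∧ r j < r i) := by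
  rcases eq_or_ne i j with rfl | hij
  · simp
  have hj := h.lt j
  have key : l i < r j → r j < r i → (ChordAbove y l r i j ↔
      chordHeight y (l i) (r i) (r j) < y (r j)) := by
    intro h1 h2
    rw [h.chordAbove_iff hij (x := r j) (by simp [*, h.lt i, hj.trans h2]) (by simp [hj.le, h1.le])
      (by simp [h2.le]) (Or.inl ⟨h1, h2⟩), chordHeight_right y hj]
  constructor
  · rintro ⟨h1, h2, h3⟩
    exact ⟨(key h1 h2).2 h3, h2⟩
  · rintro ⟨h1, h2⟩
    have h3 : l i < r j := (le_max_left _ _).trans_lt (h1.1.trans_le (min_le_right _ _))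
    exact ⟨h3, h2, (key h3 h2).1 h1⟩

theorem NonCrossing.common_left_iff (h : NonCrossing y l r) (i j : ι) :
    (l j = l i ∧ chordSlope y (l i) (r i) < chordSlope y (l j) (r j)) ↔
      (ChordAbove y l r i j ∧ l j = l i) := by
  rw [and_comm, and_congr_left_iff]
  intro hl
  have hlt : max (l i) (l j) < min (r i) (r j) := by
    rw [hl, max_self]
    exact lt_min (h.lt i) (hl ▸ h.lt j)
  have hm : 0 < (max (l i) (l j) + min (r i) (r j)) / 2 - l i := by
    have := le_max_left (l i) (l j)
    linarith
  rw [ChordAbove, and_iff_right hlt, chordHeight, chordHeight, hl, max_self, ← sub_pos]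
  rw [hl, max_self] at hm
  rw [← mul_pos_iff_of_pos_right hm]
  ring_nf

theorem NonCrossing.common_right_iff (h : NonCrossing y l r) (i j : ι) :
    (r j = r i ∧ chordSlope y (l j) (r j) < chordSlope y (l i) (r i)) ↔
      (ChordAbove y l r i j ∧ r j = r i) := by
  rw [and_comm, and_congr_left_iff]
  intro hr
  have hlt : max (l i) (l j) < min (r i) (r j) := by
    rw [hr, min_self]
    exact max_lt (h.lt i) (hr ▸ h.lt j)
  have hm : 0 < r i - (max (l i) (l j) + min (r i) (r j)) / 2 := by
    have := min_le_left (r i) (r j)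
    linarith
  rw [ChordAbove, and_iff_right hlt, chordHeight_sub y (l j) (r j) _ (r j),
    chordHeight_sub y (l i) (r i) _ (r i), chordHeight_right y (h.lt i),
    chordHeight_right y (h.lt j), ← sub_pos, ← mul_pos_iff_of_pos_right hm]
  rw [hr]
  ring_nf

/-- Distinct segments with a common left end and equal slopes would overlap. Hence slopes order the
segments at a common end strictly. -/
theorem NonCrossing.eq_of_left (h : NonCrossing y l r) {i j : ι} (hl : l i = l j)
    (hs : chordSlope y (l i) (r i) = chordSlope y (l j) (r j)) : i = j := by
  by_contra hij
  have hlt : l i < min (r i) (r j) := lt_min (h.lt i) (hl ▸ h.lt j)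
  refine h.diff_ne_zero hij (x := (l i + min (r i) (r j)) / 2) ?_ (by linarith) (Or.inl ⟨?_, ?_⟩) ?_
  · rw [← hl, max_self]; linarith
  · linarith
  · have := min_le_left (r i) (r j); linarith
  · rw [chordHeight, chordHeight, hl, ← hs, hl, sub_self]

theorem NonCrossing.eq_of_right (h : NonCrossing y l r) {i j : ι} (hr : r i = r j)
    (hs : chordSlope y (l i) (r i) = chordSlope y (l j) (r j)) : i = j := by
  by_contra hij
  have hlt : max (l i) (l j) < r i := max_lt (h.lt i) (hr ▸ h.lt j)
  refine h.diff_ne_zero hij (x := (max (l i) (l j) + r i) / 2) (by linarith) ?_ (Or.inl ⟨?_, ?_⟩) ?_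
  · rw [← hr, min_self]; linarith
  · have := le_max_left (l i) (l j); linarith
  · linarith
  · rw [chordHeight_sub y (l j) (r j) _ (r j), chordHeight_sub y (l i) (r i) _ (r i),
      chordHeight_right y (h.lt i), chordHeight_right y (h.lt j), hs, hr, sub_self]

end Segments

/-! ### Parity of the segments above a point -/

section Parity

variable {ι : Type*} [Fintype ι] {y : ℝ → ℝ} {l r : ι → ℝ} {c : ι → ZMod 2}

-- The cycle condition `hc`, summed over the finitely many end positions that satisfy `P`.
open Classical in
theorem sum_ends_eq_zero (hc : ∀ x, ∑ j, ((if l j = x then c j else 0) +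
    (if r j = x then c j else 0)) = 0) (P : ℝ → Prop) :
    ∑ j, ((if P (l j) then c j else 0) + (if P (r j) then c j else 0)) = 0 := by
  set F : Finset ℝ := (Finset.univ.image l ∪ Finset.univ.image r).filter P with hF
  have h0 : ∑ x ∈ F, ∑ j, ((if l j = x then c j else 0) + (if r j = x then c j else 0)) = 0 :=
    Finset.sum_eq_zero fun x _ => hc x
  rw [Finset.sum_comm] at h0
  refine Eq.trans ?_ h0
  refine Finset.sum_congr rfl fun j _ => ?_
  rw [Finset.sum_add_distrib, Finset.sum_ite_eq, Finset.sum_ite_eq]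
  simp [hF]

variable (y l r c)

open Classical in
/-- Parity of the segments strictly above the point over `v`. -/
noncomputable def parityAbove (v : ℝ) : ZMod 2 :=
  ∑ j, if l j < v ∧ v < r j ∧ y v < chordHeight y (l j) (r j) v then c j else 0

variable {y l r c}

open Classical in
/-- The region just above a segment has the same parity at both ends of the segment. -/
theorem NonCrossing.parity_edge (h : NonCrossing y l r)
    (hc : ∀ x, ∑ j, ((if l j = x then c j else 0) + (if r j = x then c j else 0)) = 0) (i : ι) :
    parityAbove y l r c (l i) +
        ∑ j, (if l j = l i ∧ chordSlope y (l i) (r i) < chordSlope y (l j) (r j)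
          then c j else 0) =
      parityAbove y l r c (r i) +
        ∑ j, (if r j = r i ∧ chordSlope y (l j) (r j) < chordSlope y (l i) (r i)
          then c j else 0) := by
  -- Count the ends that lie strictly above segment `i`; mod 2 their total is the difference of the
  -- two sides.
  have h0 := sum_ends_eq_zero hc (fun x => l i < x ∧ x < r i ∧ chordHeight y (l i) (r i) x < y x)
  rw [← sub_eq_zero, CharTwo.sub_eq_add, parityAbove, parityAbove]
  refine Eq.trans ?_ h0
  simp only [← Finset.sum_add_distrib]
  refine Finset.sum_congr rfl fun j _ => ?_
  simp only [h.above_left_iff, h.above_right_iff, h.left_above_iff, h.right_above_iff,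
    h.common_left_iff, h.common_right_iff]
  -- A segment `j` above `i` contributes `c j` exactly once for its left end (lying before, at or
  -- after `l i`) and once for its right end, so the two cancel. Other segments contribute nothing.
  by_cases ha : ChordAbove y l r i j
  · simp only [ha, true_and]
    have h2 : c j + c j = 0 := CharTwo.add_self_eq_zero _
    rcases lt_trichotomy (l j) (l i) with h1 | h1 | h1 <;>
      rcases lt_trichotomy (r j) (r i) with h3 | h3 | h3 <;>
      simp [h1, h3, h1.not_gt, h3.not_gt, LT.lt.ne, LT.lt.ne', h2]
  · simp [ha]

/-- First end of an oriented segment. -/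
def chordStart {X : Type*} (l r : ι → X) (d : ι × Bool) : X := if d.2 then l d.1 else r d.1

/-- Segments at a common end in counterclockwise order: first those to the right, then those to
the left, both by slope. -/
noncomputable def chordKey (y : ℝ → ℝ) (l r : ι → ℝ) (d : ι × Bool) : Bool ×ₗ ℝ :=
  toLex (!d.2, chordSlope y (l d.1) (r d.1))

omit [Fintype ι] in
theorem NonCrossing.chordKey_inj (h : NonCrossing y l r) (d e : ι × Bool)
    (hs : chordStart l r d = chordStart l r e) (hk : chordKey y l r d = chordKey y l r e) :
    d = e := by
  obtain ⟨i, b⟩ := d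
  obtain ⟨j, b'⟩ := e
  have hk' := toLex.injective hk
  simp only [Prod.mk.injEq, Bool.not_inj_iff] at hk'
  obtain ⟨rfl, hk'⟩ := hk'
  cases b
  · rw [h.eq_of_right (by simpa [chordStart] using hs) hk']
  · rw [h.eq_of_left (by simpa [chordStart] using hs) hk']

open Classical in
/-- Parity of the region to the left of an oriented segment, near its start. -/
noncomputable def parityLeft (y : ℝ → ℝ) (l r : ι → ℝ) (c : ι → ZMod 2) (d : ι × Bool) : ZMod 2 :=
  parityAbove y l r c (chordStart l r d) +
    (∑ j, if r j = chordStart l r d then c j else 0) +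
    ∑ e : ι × Bool, if chordStart l r e = chordStart l r d ∧ chordKey y l r d < chordKey y l r e
      then c e.1 else 0

-- For a segment directed to the right, the left side is above it. All leftward segments have larger
-- keys and cancel the middle sum of `parityLeft`.
open Classical in
theorem parityLeft_true (i : ι) : parityLeft y l r c (i, true) = parityAbove y l r c (l i) +
    ∑ j, (if l j = l i ∧ chordSlope y (l i) (r i) < chordSlope y (l j) (r j) then c j else 0) := by
  rw [parityLeft, Fintype.sum_prod_type]
  simp only [Fintype.sum_bool, chordStart, chordKey, Prod.Lex.toLex_lt_toLex, Finset.sum_add_distrib]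
  simp only [Bool.not_true, Bool.not_false, if_true, lt_irrefl, false_or, true_and,
    Bool.false_lt_true, true_or, and_true, Bool.false_eq_true, if_false]
  have h2 := CharTwo.add_self_eq_zero (∑ j, if r j = l i then c j else 0)
  linear_combination h2

-- For a segment directed to the left, the left side is below it, so the segment itself is counted
-- too. At a right end smaller slope means higher, and the segments of larger slope cancel.
open Classical in
theorem NonCrossing.parityLeft_false (h : NonCrossing y l r) (i : ι) :
    parityLeft y l r c (i, false) = parityAbove y l r c (r i) +
    ∑ j, (if r j = r i ∧ chordSlope y (l j) (r j) < chordSlope y (l i) (r i) then c j else 0) +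
      c i := by
  rw [parityLeft, Fintype.sum_prod_type]
  simp only [Fintype.sum_bool, chordStart, chordKey, Prod.Lex.toLex_lt_toLex]
  simp only [Bool.not_true, Bool.not_false, if_true, lt_irrefl, false_or, true_and,
    Bool.false_eq_true, if_false]
  have ht : ¬ (true < false) := by decide
  simp only [ht, false_or, false_and, and_false, if_false, zero_add, Bool.true_eq_false]
  rw [add_assoc, add_assoc]
  congr 1
  have hci : c i = ∑ j, if j = i then c j else 0 := by simp
  rw [hci, ← Finset.sum_add_distrib, ← Finset.sum_add_distrib]
  refine Finset.sum_congr rfl fun j _ => ?_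
  have h2 : c j + c j = 0 := CharTwo.add_self_eq_zero _
  rcases eq_or_ne j i with rfl | hji
  · simp
  by_cases hr : r j = r i
  · have hs : chordSlope y (l j) (r j) ≠ chordSlope y (l i) (r i) :=
      fun hs => hji (h.eq_of_right hr hs)
    generalize chordSlope y (l j) (r j) = s, chordSlope y (l i) (r i) = t at hs ⊢
    rcases lt_or_gt_of_ne hs with hs | hs <;> simp [hji, hr, hs, hs.not_gt, h2]
  · simp [hji, hr]

/-- The dart relation of a family of non-crossing segments: `next` turns counterclockwise about the
start, and every cycle with coefficients in `ZMod 2` bounds. -/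
theorem NonCrossing.exists_next (h : NonCrossing y l r) :
    ∃ next : ι × Bool → ι × Bool, (∀ d, chordStart l r (next d) = chordStart l r d) ∧
      (∀ d e, e ≠ d → chordStart l r e = chordStart l r d → next d ≠ d) ∧
      ∀ c : ι → ZMod 2, (∀ x, (∑ d : ι × Bool, open Classical in
          if chordStart l r d = x then c d.1 else 0) = 0) →
        ∃ T : ι × Bool → ZMod 2, (∀ i b, T (i, b) + T (i, !b) = c i) ∧
          ∀ d, T d = T ((next d).1, !(next d).2) := by
  classical
  obtain ⟨next, h1, h2, h3⟩ := exists_cyclic_next (chordStart l r) (chordKey y l r) h.chordKey_inj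
  refine ⟨next, h1, h2, fun c hc => ?_⟩
  have hflip : ∀ i b, parityLeft y l r c (i, b) + parityLeft y l r c (i, !b) = c i := by
    have hc' : ∀ x, ∑ j, ((if l j = x then c j else 0) + (if r j = x then c j else 0)) = 0 := by
      intro x
      refine Eq.trans ?_ (hc x)
      rw [Fintype.sum_prod_type]
      simp [chordStart]
    have key : ∀ i, parityLeft y l r c (i, true) + parityLeft y l r c (i, false) = c i := by
      intro i
      rw [h.parityLeft_false, parityLeft_true, h.parity_edge hc', ← add_assoc,
        CharTwo.add_self_eq_zero, zero_add]
    intro i b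
    cases b
    · rw [add_comm]; exact key i
    · exact key i
  refine ⟨parityLeft y l r c, hflip, fun d => ?_⟩
  -- Turning from `d` to `next d` crosses only the segment `next d`: the left of `d` is the right of
  -- `next d`.
  have hd : parityLeft y l r c d = parityLeft y l r c (next d) + c (next d).1 := by
    rw [parityLeft, parityLeft, h1, h3 (fun d => c d.1) hc d, add_assoc (_ + _)]
    congr 1
    have hci : c (next d).1 = ∑ e, if e = next d then c e.1 else 0 := by simp
    rw [hci, ← Finset.sum_add_distrib]
    refine Finset.sum_congr rfl fun e _ => ?_
    rcases eq_or_ne e (next d) with rfl | hne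
    · simp [h1]
    · by_cases hs : chordStart l r e = chordStart l r d
      · have hk : chordKey y l r (next d) ≠ chordKey y l r e := fun hk =>
          hne (h.chordKey_inj _ _ (hs.trans (h1 d).symm) hk.symm)
        simp [hne, hs, le_iff_lt_or_eq, hk]
      · simp [hne, hs]
  rw [hd, ← hflip (next d).1 (next d).2, ← add_assoc, CharTwo.add_self_eq_zero, zero_add]

end Parity

/-! ### Segments in the plane, in general position after a shear -/

section Plane

variable {ι : Type*}

/-- Finitely many points of the plane have different images under a generic linear form. -/
theorem exists_generic_form (E : Finset (ℝ × ℝ)) :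
    ∃ t : ℝ, ∀ p ∈ E, ∀ q ∈ E, p.1 + t * p.2 = q.1 + t * q.2 → p = q := by
  classical
  -- The excluded values are those that identify two points with different second coordinates.
  obtain ⟨t, ht⟩ := Infinite.exists_notMem_finset
    ((E ×ˢ E).image fun pq => -(pq.1.1 - pq.2.1) / (pq.1.2 - pq.2.2))
  refine ⟨t, fun p hp q hq h => ?_⟩
  by_cases h2 : p.2 = q.2
  · rw [h2] at h
    exact Prod.ext (by linarith) h2
  · refine absurd (Finset.mem_image.2 ⟨(p, q), Finset.mem_product.2 ⟨hp, hq⟩, ?_⟩) ht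
    rw [div_eq_iff (sub_ne_zero.2 h2)]
    linarith

theorem chordHeight_eq_of_ne {y : ℝ → ℝ} {a b : ℝ} (hab : a ≠ b) (x : ℝ) :
    chordHeight y (min a b) (max a b) x = y a + (x - a) / (b - a) * (y b - y a) := by
  have h1 : b - a ≠ 0 := sub_ne_zero.2 hab.symm
  have h2 : a - b ≠ 0 := sub_ne_zero.2 hab
  rcases lt_or_gt_of_ne hab with h | h
  · rw [min_eq_left h.le, max_eq_right h.le, chordHeight, chordSlope]
    ring
  · rw [min_eq_right h.le, max_eq_left h.le, chordHeight, chordSlope]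
    rw [← neg_sub a b]
    field_simp
    ring

/-- The dart relation of finitely many straight segments that meet at most in common ends. -/
theorem exists_next_of_segments [Fintype ι] (A B : ι → ℝ × ℝ) (hne : ∀ i, A i ≠ B i)
    (hmeet : ∀ i j, i ≠ j → ∀ z ∈ segment ℝ (A i) (B i), z ∈ segment ℝ (A j) (B j) →
      (z = A i ∨ z = B i) ∧ (z = A j ∨ z = B j)) :
    ∃ next : ι × Bool → ι × Bool, (∀ d, chordStart A B (next d) = chordStart A B d) ∧
      (∀ d e, e ≠ d → chordStart A B e = chordStart A B d → next d ≠ d) ∧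
      ∀ c : ι → ZMod 2, (∀ x, (∑ d : ι × Bool, open Classical in
          if chordStart A B d = x then c d.1 else 0) = 0) →
        ∃ T : ι × Bool → ZMod 2, (∀ i b, T (i, b) + T (i, !b) = c i) ∧
          ∀ d, T d = T ((next d).1, !(next d).2) := by
  classical
  obtain ⟨t, ht⟩ := exists_generic_form (Finset.univ.image (chordStart A B))
  -- With `X` as abscissa no segment is vertical and distinct ends have distinct abscissas, so all
  -- ends lie on the graph of one function `y`.
  set X : ℝ × ℝ → ℝ := fun p => p.1 + t * p.2 with hX
  have hXinj : ∀ d e, X (chordStart A B d) = X (chordStart A B e) →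
      chordStart A B d = chordStart A B e := fun d e h =>
    ht _ (Finset.mem_image_of_mem _ (Finset.mem_univ _)) _
      (Finset.mem_image_of_mem _ (Finset.mem_univ _)) h
  obtain ⟨y, hy⟩ : ∃ y : ℝ → ℝ, ∀ d, y (X (chordStart A B d)) = (chordStart A B d).2 := by
    refine ⟨fun x => if h : ∃ d, X (chordStart A B d) = x then (chordStart A B h.choose).2 else 0,
      fun d => ?_⟩
    have h : ∃ e, X (chordStart A B e) = X (chordStart A B d) := ⟨d, rfl⟩
    simp only [dif_pos h]
    rw [hXinj _ _ h.choose_spec]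
  have hyA : ∀ i, y (X (A i)) = (A i).2 := fun i => hy (i, true)
  have hyB : ∀ i, y (X (B i)) = (B i).2 := fun i => hy (i, false)
  have hXne : ∀ i, X (A i) ≠ X (B i) := fun i h => hne i (hXinj (i, true) (i, false) h)
  set l : ι → ℝ := fun i => min (X (A i)) (X (B i)) with hl
  set r : ι → ℝ := fun i => max (X (A i)) (X (B i)) with hr
  have hpt : ∀ i x, l i ≤ x → x ≤ r i → ∃ z ∈ segment ℝ (A i) (B i), X z = x ∧
      z.2 = chordHeight y (l i) (r i) x := by
    intro i x h1 h2
    have hba : X (B i) - X (A i) ≠ 0 := sub_ne_zero.2 (hXne i).symm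
    refine ⟨AffineMap.lineMap (A i) (B i) ((x - X (A i)) / (X (B i) - X (A i))), ?_, ?_, ?_⟩
    · rw [segment_eq_image_lineMap]
      refine ⟨_, ⟨?_, ?_⟩, rfl⟩ <;> rcases lt_or_gt_of_ne (hXne i) with h | h
      · simp only [hl, min_eq_left h.le] at h1
        exact div_nonneg (by linarith) (by linarith)
      · simp only [hr, max_eq_left h.le] at h2
        exact div_nonneg_of_nonpos (by linarith) (by linarith)
      · simp only [hr, max_eq_right h.le] at h2
        exact div_le_one_of_le₀ (by linarith) (by linarith)
      · simp only [hl, min_eq_right h.le] at h1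
        exact div_le_one_of_ge (by linarith) (by linarith)
    · have : X (AffineMap.lineMap (A i) (B i) ((x - X (A i)) / (X (B i) - X (A i)))) =
          X (A i) + (x - X (A i)) / (X (B i) - X (A i)) * (X (B i) - X (A i)) := by
        simp only [hX, AffineMap.lineMap_apply, vsub_eq_sub, vadd_eq_add, Prod.fst_add,
          Prod.snd_add, Prod.smul_fst, Prod.smul_snd, smul_eq_mul, Prod.fst_sub, Prod.snd_sub]
        ring
      rw [this, div_mul_cancel₀ _ hba]
      ring
    · rw [chordHeight_eq_of_ne (hXne i), hyA, hyB]
      simp only [AffineMap.lineMap_apply, vsub_eq_sub, vadd_eq_add,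
          Prod.snd_add, Prod.smul_snd, smul_eq_mul, Prod.snd_sub]
      ring
  have hend : ∀ i x z, X z = x → (z = A i ∨ z = B i) → x = l i ∨ x = r i := by
    rintro i x z rfl (rfl | rfl) <;> rcases le_total (X (A i)) (X (B i)) with h | h <;>
      simp [hl, hr, h]
  have hnc : NonCrossing y l r := by
    refine ⟨fun i => min_lt_max.2 (hXne i), fun i j hij x h1 h2 h3 h4 h5 => ?_⟩
    obtain ⟨z, hz, hzx, hz2⟩ := hpt i x h1 h2
    obtain ⟨z', hz', hzx', hz2'⟩ := hpt j x h3 h4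
    have hzz : z' = z := by
      have h2 : z'.2 = z.2 := by rw [hz2, hz2', h5]
      refine Prod.ext ?_ h2
      have := hzx'.trans hzx.symm
      simp only [hX, h2] at this
      linarith
    rw [hzz] at hz'
    obtain ⟨e1, e2⟩ := hmeet i j hij z hz hz'
    exact ⟨hend i x z hzx e1, hend j x z hzx e2⟩
  -- Chords run from left to right, while `A i` may lie to the right of `B i`; `s` translates
  -- between the two orientations.
  set s : ι × Bool → ι × Bool :=
    fun d => (d.1, if X (A d.1) < X (B d.1) then d.2 else !d.2) with hs
  have hss : Function.Involutive s := by
    rintro ⟨i, b⟩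
    by_cases h : X (A i) < X (B i) <;> simp [hs, h]
  have hsX : ∀ d, chordStart l r (s d) = X (chordStart A B d) := by
    rintro ⟨i, b⟩
    rcases lt_or_gt_of_ne (hXne i) with h | h <;> cases b <;>
      simp [hs, hl, hr, chordStart, h, h.le, h.not_gt]
  have hsX' : ∀ d, chordStart l r d = X (chordStart A B (s d)) := fun d => by
    rw [← hsX, hss]
  obtain ⟨next, h1, h2, h3⟩ := hnc.exists_next
  refine ⟨fun d => s (next (s d)), fun d => hXinj _ _ ?_, fun d e hed he hd => ?_, fun c hc => ?_⟩
  · rw [← hsX', h1, hsX]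
  · refine h2 (s d) (s e) (hss.injective.ne hed) (by rw [hsX, hsX, he]) ?_
    exact (hss _).symm.trans (congrArg s hd)
  · obtain ⟨T, hT1, hT2⟩ := h3 c (by
      intro x
      by_cases hx : ∃ d, X (chordStart A B d) = x
      · obtain ⟨d, rfl⟩ := hx
        refine Eq.trans ?_ (hc (chordStart A B d))
        refine (Equiv.sum_comp hss.toPerm _).symm.trans ?_
        refine Finset.sum_congr rfl fun e _ => ?_
        simp only [Function.Involutive.coe_toPerm, hsX]
        by_cases he : chordStart A B e = chordStart A B d
        · simp [he, hs]
        · rw [if_neg he, if_neg fun h => he (hXinj _ _ h)]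
      · refine Finset.sum_eq_zero fun e _ => if_neg fun he => hx ⟨s e, ?_⟩
        rw [← hsX', he])
    have hsn : ∀ i b, s (i, !b) = ((s (i, b)).1, !(s (i, b)).2) := by
      intro i b
      by_cases h : X (A i) < X (B i) <;> simp [hs, h]
    refine ⟨fun d => T (s d), fun i b => ?_, fun d => ?_⟩
    · simp only [hsn]
      exact hT1 _ _
    · simp only [hsn, Prod.mk.eta, hss (next (s d))]
      exact hT2 (s d)

end Plane

/-! ### Polygonal drawings, cut into straight pieces -/

section Drawing

variable {V : Type*} {G : SimpleGraph V}

/-- A planar drawing of a graph by polygonal arcs, every arc with a chosen direction. -/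
structure PolygonalDrawing (G : SimpleGraph V) where
  point : V → ℝ × ℝ
  tail : G.edgeSet → V
  head : G.edgeSet → V
  len : G.edgeSet → ℕ
  path : G.edgeSet → ℝ → ℝ × ℝ
  point_injective : Function.Injective point
  edge_eq : ∀ e, e.1 = s(tail e, head e)
  path_line : ∀ e, ∀ i < len e, ∀ t ∈ Set.Icc (0 : ℝ) 1,
    path e (i + t) = AffineMap.lineMap (path e i) (path e (i + 1)) t
  path_injOn : ∀ e, Set.InjOn (path e) (Set.Icc 0 (len e))
  path_zero : ∀ e, path e 0 = point (tail e)
  path_len : ∀ e, path e (len e) = point (head e)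
  point_mem : ∀ e w, ∀ t ∈ Set.Icc (0 : ℝ) (len e), path e t = point w → w ∈ e.1
  path_meet : ∀ e f, e ≠ f → ∀ s ∈ Set.Icc (0 : ℝ) (len e), ∀ t ∈ Set.Icc (0 : ℝ) (len f),
    path e s = path f t → ∃ w, w ∈ e.1 ∧ w ∈ f.1 ∧ point w = path e s

theorem SimpleGraph.IsPlanar.nonempty_polygonalDrawing (h : G.IsPlanar) :
    Nonempty (PolygonalDrawing G) := by
  obtain ⟨p, arc, hp, harc, hpt, hmeet⟩ := h
  have hex : ∀ e : G.edgeSet, ∃ (u v : V) (n : ℕ) (γ : ℝ → ℝ × ℝ), e.1 = s(u, v) ∧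
      (∀ i < n, ∀ t ∈ Set.Icc (0 : ℝ) 1,
        γ (i + t) = AffineMap.lineMap (γ i) (γ (i + 1)) t) ∧
      Set.InjOn γ (Set.Icc 0 n) ∧ γ 0 = p u ∧ γ n = p v ∧ γ '' Set.Icc 0 n = arc e.1 := by
    rintro ⟨e, he⟩
    induction e with
    | _ u v =>
      obtain ⟨n, γ, h⟩ := harc u v he
      exact ⟨u, v, n, γ, rfl, h⟩
  choose u v n γ h1 h2 h3 h4 h5 h6 using hex
  have hmem : ∀ e, ∀ t ∈ Set.Icc (0 : ℝ) (n e), γ e t ∈ arc e.1 := fun e t ht =>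
    h6 e ▸ Set.mem_image_of_mem _ ht
  exact ⟨⟨p, u, v, n, γ, hp, h1, h2, h3, h4, h5,
    fun e w t ht hw => hpt e.1 e.2 w (hw ▸ hmem e t ht),
    fun e f hef s hs t ht hst => hmeet e.1 e.2 f.1 f.2 (fun h => hef (Subtype.ext h)) _
      ⟨hmem e s hs, hst ▸ hmem f t ht⟩⟩⟩

namespace PolygonalDrawing

variable (D : PolygonalDrawing G)

theorem tail_ne_head (e : G.edgeSet) : D.tail e ≠ D.head e := by
  have h := e.2
  rw [D.edge_eq e, SimpleGraph.mem_edgeSet] at h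
  exact h.ne

theorem len_pos (e : G.edgeSet) : 0 < D.len e := by
  rw [Nat.pos_iff_ne_zero]
  intro h
  have h1 := D.path_len e
  rw [h, Nat.cast_zero, D.path_zero] at h1
  exact D.tail_ne_head e (D.point_injective h1)

theorem eq_zero_or_len {e : G.edgeSet} {w : V} {t : ℝ} (ht : t ∈ Set.Icc (0 : ℝ) (D.len e))
    (h : D.path e t = D.point w) : (t = 0 ∧ w = D.tail e) ∨ (t = D.len e ∧ w = D.head e) := by
  have hw := D.point_mem e w t ht h
  rw [D.edge_eq e, Sym2.mem_iff] at hw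
  rcases hw with rfl | rfl
  · exact Or.inl ⟨D.path_injOn e ht ⟨le_rfl, Nat.cast_nonneg _⟩ (h.trans (D.path_zero e).symm), rfl⟩
  · exact Or.inr ⟨D.path_injOn e ht ⟨Nat.cast_nonneg _, le_rfl⟩ (h.trans (D.path_len e).symm), rfl⟩

theorem meet_ends {e f : G.edgeSet} (hef : e ≠ f) {s t : ℝ} (hs : s ∈ Set.Icc (0 : ℝ) (D.len e))
    (ht : t ∈ Set.Icc (0 : ℝ) (D.len f)) (h : D.path e s = D.path f t) :
    (s = 0 ∨ s = D.len e) ∧ (t = 0 ∨ t = D.len f) := by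
  obtain ⟨w, -, -, hw⟩ := D.path_meet e f hef s hs t ht h
  exact ⟨(D.eq_zero_or_len hs hw.symm).imp And.left And.left,
    (D.eq_zero_or_len ht (h.symm.trans hw.symm)).imp And.left And.left⟩

/-- The straight pieces of the arcs of a drawing. -/
abbrev Piece : Type _ := Σ e : G.edgeSet, Fin (D.len e)

/-- First end of a piece, in the direction of its arc. -/
def pieceTail (x : D.Piece) : ℝ × ℝ := D.path x.1 (x.2 : ℕ)

/-- Second end of a piece, in the direction of its arc. -/
def pieceHead (x : D.Piece) : ℝ × ℝ := D.path x.1 ((x.2 : ℕ) + 1)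

theorem piece_mem (x : D.Piece) {t : ℝ} (ht : t ∈ Set.Icc (0 : ℝ) 1) :
    ((x.2 : ℕ) : ℝ) + t ∈ Set.Icc (0 : ℝ) (D.len x.1) := by
  have h1 : ((x.2 : ℕ) : ℝ) + 1 ≤ D.len x.1 := by exact_mod_cast x.2.2
  have h2 : (0 : ℝ) ≤ (x.2 : ℕ) := Nat.cast_nonneg _
  exact ⟨add_nonneg h2 ht.1, by linarith [ht.2]⟩

theorem pieceTail_ne_pieceHead (x : D.Piece) : D.pieceTail x ≠ D.pieceHead x := by
  intro h
  have h0 := D.piece_mem x (t := 0) (by simp)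
  rw [add_zero] at h0
  have := D.path_injOn x.1 h0 (D.piece_mem x (t := 1) (by simp)) h
  linarith

theorem exists_of_mem_piece (x : D.Piece) {z : ℝ × ℝ}
    (hz : z ∈ segment ℝ (D.pieceTail x) (D.pieceHead x)) :
    ∃ t ∈ Set.Icc (0 : ℝ) 1, z = D.path x.1 ((x.2 : ℕ) + t) := by
  rw [segment_eq_image_lineMap] at hz
  obtain ⟨t, ht, rfl⟩ := hz
  exact ⟨t, ht, (D.path_line x.1 _ x.2.2 t ht).symm⟩

theorem piece_end_of_arc_end (x : D.Piece) {t : ℝ} (ht : t ∈ Set.Icc (0 : ℝ) 1)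
    (h : ((x.2 : ℕ) : ℝ) + t = 0 ∨ ((x.2 : ℕ) : ℝ) + t = D.len x.1) :
    D.path x.1 ((x.2 : ℕ) + t) = D.pieceTail x ∨ D.path x.1 ((x.2 : ℕ) + t) = D.pieceHead x := by
  have h1 : ((x.2 : ℕ) : ℝ) + 1 ≤ D.len x.1 := by exact_mod_cast x.2.2
  have h2 : (0 : ℝ) ≤ (x.2 : ℕ) := Nat.cast_nonneg _
  rcases h with h | h
  · have : t = 0 := by linarith [ht.1]
    left
    rw [this, add_zero, pieceTail]
  · have : t = 1 := by linarith [ht.2]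
    right
    rw [this, pieceHead]

/-- Pieces of one arc meet only at a shared bend, by injectivity of the path. Different arcs meet
only at their ends, which are also ends of pieces. -/
theorem piece_meet (x z : D.Piece) (hxz : x ≠ z) (q : ℝ × ℝ)
    (hx : q ∈ segment ℝ (D.pieceTail x) (D.pieceHead x))
    (hz : q ∈ segment ℝ (D.pieceTail z) (D.pieceHead z)) :
    (q = D.pieceTail x ∨ q = D.pieceHead x) ∧ (q = D.pieceTail z ∨ q = D.pieceHead z) := by
  obtain ⟨s, hs, rfl⟩ := D.exists_of_mem_piece x hx
  obtain ⟨t, ht, h⟩ := D.exists_of_mem_piece z hz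
  by_cases hef : x.1 = z.1
  · obtain ⟨e, k⟩ := x
    obtain ⟨f, m⟩ := z
    obtain rfl : e = f := hef
    have hst := D.path_injOn e (D.piece_mem ⟨e, k⟩ hs) (D.piece_mem ⟨e, m⟩ ht) h
    have hkm : (k : ℕ) ≠ m := fun h => hxz (by rw [Fin.ext h])
    simp only at hst
    simp only [pieceTail, pieceHead]
    rcases lt_or_gt_of_ne hkm with hlt | hlt
    · have h1 : ((k : ℕ) : ℝ) + 1 ≤ (m : ℕ) := by exact_mod_cast hlt
      have hs1 : s = 1 := by linarith [hs.2, ht.1]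
      have ht0 : t = 0 := by linarith [hs.2, ht.1]
      subst hs1 ht0
      rw [hst, add_zero]
      exact ⟨Or.inr rfl, Or.inl rfl⟩
    · have h1 : ((m : ℕ) : ℝ) + 1 ≤ (k : ℕ) := by exact_mod_cast hlt
      have ht1 : t = 1 := by linarith [ht.2, hs.1]
      have hs0 : s = 0 := by linarith [ht.2, hs.1]
      subst hs0 ht1
      rw [add_zero] at hst ⊢
      exact ⟨Or.inl rfl, Or.inr (by rw [hst])⟩
  · have hends := D.meet_ends hef (D.piece_mem x hs) (D.piece_mem z ht) h
    refine ⟨D.piece_end_of_arc_end x hs hends.1, ?_⟩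
    rw [h]
    exact D.piece_end_of_arc_end z ht hends.2

theorem chordStart_piece (e : G.edgeSet) (k : Fin (D.len e)) (b : Bool) :
    chordStart D.pieceTail D.pieceHead (⟨e, k⟩, b) =
      D.path e (((k : ℕ) + if b then 0 else 1 : ℕ) : ℝ) := by
  cases b <;> simp [chordStart, pieceTail, pieceHead]

open Classical in
/-- The first piece of the arc of a dart, directed away from the start of the dart. -/
noncomputable def first (d : G.Dart) : D.Piece × Bool :=
  if d.fst = D.tail ⟨d.edge, d.edge_mem⟩ then (⟨⟨d.edge, d.edge_mem⟩, ⟨0, D.len_pos _⟩⟩, true)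
  else (⟨⟨d.edge, d.edge_mem⟩, ⟨D.len ⟨d.edge, d.edge_mem⟩ - 1,
    Nat.sub_lt (D.len_pos _) one_pos⟩⟩, false)

theorem first_edge (d : G.Dart) : (D.first d).1.1 = ⟨d.edge, d.edge_mem⟩ := by
  unfold first
  split_ifs <;> rfl

theorem fst_eq (d : G.Dart) : d.fst = D.tail ⟨d.edge, d.edge_mem⟩ ∧
      d.snd = D.head ⟨d.edge, d.edge_mem⟩ ∨
    d.fst = D.head ⟨d.edge, d.edge_mem⟩ ∧ d.snd = D.tail ⟨d.edge, d.edge_mem⟩ := by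
  have h := D.edge_eq ⟨d.edge, d.edge_mem⟩
  exact SimpleGraph.dart_edge_eq_mk'_iff'.1 h

theorem chordStart_first (d : G.Dart) :
    chordStart D.pieceTail D.pieceHead (D.first d) = D.point d.fst := by
  unfold first
  split_ifs with h
  · rw [chordStart_piece]
    simp [h, D.path_zero]
  · rw [chordStart_piece]
    have h' : d.fst = D.head ⟨d.edge, d.edge_mem⟩ := by
      rcases D.fst_eq d with h1 | h1
      · exact absurd h1.1 h
      · exact h1.1
    have hn : D.len ⟨d.edge, d.edge_mem⟩ - 1 + 1 = D.len ⟨d.edge, d.edge_mem⟩ :=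
      Nat.sub_add_cancel (Nat.succ_le_of_lt (D.len_pos _))
    simp only [Bool.false_eq_true, if_false]
    rw [hn, D.path_len, h']

theorem first_injective : Function.Injective D.first := by
  intro d d' h
  have he : d.edge = d'.edge := by
    have := congrArg (fun x => x.1.1) h
    simp only [first_edge] at this
    exact congrArg Subtype.val this
  have hs : d.fst = d'.fst := D.point_injective (by rw [← chordStart_first, ← chordStart_first, h])
  rcases SimpleGraph.dart_edge_eq_iff d d' |>.1 he with h | h
  · exact h
  · rw [h] at hs
    exact absurd hs d'.snd_ne_fst

theorem first_of_fst_eq_tail {d : G.Dart} {e : G.edgeSet} (he : d.edge = e.1)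
    (h : d.fst = D.tail e) : D.first d = (⟨e, ⟨0, D.len_pos e⟩⟩, true) := by
  obtain rfl : e = ⟨d.edge, d.edge_mem⟩ := Subtype.ext he.symm
  rw [first, if_pos h]

theorem first_of_fst_eq_head {d : G.Dart} {e : G.edgeSet} (he : d.edge = e.1)
    (h : d.fst = D.head e) :
    D.first d = (⟨e, ⟨D.len e - 1, Nat.sub_lt (D.len_pos e) one_pos⟩⟩, false) := by
  obtain rfl : e = ⟨d.edge, d.edge_mem⟩ := Subtype.ext he.symm
  rw [first, if_neg]
  rw [h]
  exact (D.tail_ne_head _).symm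

/-- An arc meets vertices only at its ends, so an oriented piece that starts at a vertex is the
first piece of a dart. This lets the rotation of pieces restrict to darts of the graph. -/
theorem exists_first_eq (x : D.Piece × Bool) (v : V)
    (h : chordStart D.pieceTail D.pieceHead x = D.point v) :
    ∃ d : G.Dart, d.fst = v ∧ D.first d = x := by
  obtain ⟨⟨e, k⟩, b⟩ := x
  have hadj : G.Adj (D.tail e) (D.head e) := by
    have := e.2
    rwa [D.edge_eq e] at this
  rw [chordStart_piece] at h
  have hk := k.2
  have ht : ((((k : ℕ) + if b then 0 else 1 : ℕ) : ℕ) : ℝ) ∈ Set.Icc (0 : ℝ) (D.len e) := by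
    refine ⟨Nat.cast_nonneg _, Nat.cast_le.2 ?_⟩
    split_ifs <;> omega
  rcases D.eq_zero_or_len ht h with ⟨h0, rfl⟩ | ⟨h0, rfl⟩
  · have h0 := Nat.cast_eq_zero.1 h0
    refine ⟨⟨(D.tail e, D.head e), hadj⟩, rfl, ?_⟩
    rw [D.first_of_fst_eq_tail (d := ⟨(D.tail e, D.head e), hadj⟩) (D.edge_eq e).symm rfl]
    cases b
    · simp at h0
    · obtain rfl : k = ⟨0, D.len_pos e⟩ := Fin.ext (by simpa using h0)
      rfl
  · have h0 := Nat.cast_injective h0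
    refine ⟨⟨(D.head e, D.tail e), hadj.symm⟩, rfl, ?_⟩
    rw [D.first_of_fst_eq_head (d := ⟨(D.head e, D.tail e), hadj.symm⟩)
      ((D.edge_eq e).trans Sym2.eq_swap).symm rfl]
    cases b
    · obtain rfl : k = ⟨D.len e - 1, Nat.sub_lt (D.len_pos e) one_pos⟩ := Fin.ext (by
        simp only [Bool.false_eq_true, if_false] at h0
        simp only
        omega)
      rfl
    · simp only [if_true, add_zero] at h0
      omega

/-- At an inner bend of an arc there are just two pieces. -/
theorem eq_of_chordStart_bend {e : G.edgeSet} {k : ℕ} (hk : k + 1 < D.len e)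
    (x : D.Piece × Bool) (h : chordStart D.pieceTail D.pieceHead x = D.path e ((k + 1 : ℕ) : ℝ)) :
    x = (⟨e, ⟨k, (Nat.lt_succ_self k).trans hk⟩⟩, false) ∨ x = (⟨e, ⟨k + 1, hk⟩⟩, true) := by
  obtain ⟨⟨f, m⟩, b⟩ := x
  rw [chordStart_piece] at h
  have hm := m.2
  have ht : ((((m : ℕ) + if b then 0 else 1 : ℕ) : ℕ) : ℝ) ∈ Set.Icc (0 : ℝ) (D.len f) := by
    refine ⟨Nat.cast_nonneg _, Nat.cast_le.2 ?_⟩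
    split_ifs <;> omega
  have hk' : ((k + 1 : ℕ) : ℝ) ∈ Set.Icc (0 : ℝ) (D.len e) :=
    ⟨Nat.cast_nonneg _, Nat.cast_le.2 hk.le⟩
  obtain rfl : f = e := by
    by_contra hfe
    rcases (D.meet_ends hfe ht hk' h).2 with h | h
    · exact absurd (Nat.cast_eq_zero.1 h) (by omega)
    · exact absurd (Nat.cast_injective h) (by omega)
  have h0 := Nat.cast_injective (D.path_injOn f ht hk' h)
  cases b
  · left
    obtain rfl : m = ⟨k, (Nat.lt_succ_self k).trans hk⟩ := Fin.ext (by simpa using h0)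
    rfl
  · right
    obtain rfl : m = ⟨k + 1, hk⟩ := Fin.ext (by simpa using h0)
    rfl

theorem sum_range_add_succ (f : ℕ → ZMod 2) (n : ℕ) :
    ∑ k ∈ Finset.range n, (f k + f (k + 1)) = f 0 + f n := by
  induction n with
  | zero => simp [CharTwo.add_self_eq_zero]
  | succ n ih =>
    rw [Finset.sum_range_succ, ih]
    linear_combination CharTwo.add_self_eq_zero (f n)

-- Each inner bend of an arc is counted twice, so the sum telescopes to the two ends of the arc.
open Classical in
theorem sum_piece_eq_zero [Fintype G.edgeSet] (C : G.edgeSet → ZMod 2)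
    (hC : ∀ v, ∑ e : G.edgeSet, (if v ∈ e.1 then C e else 0) = 0) (q : ℝ × ℝ) :
    ∑ x : D.Piece × Bool,
      (if chordStart D.pieceTail D.pieceHead x = q then C x.1.1 else 0) = 0 := by
  have h : ∀ e, ∑ k : Fin (D.len e), ∑ b : Bool,
      (if chordStart D.pieceTail D.pieceHead (⟨e, k⟩, b) = q then C e else 0) =
      (if D.point (D.tail e) = q then C e else 0) + (if D.point (D.head e) = q then C e else 0) := by
    intro e
    simp only [chordStart_piece, Fintype.sum_bool, if_true, Bool.false_eq_true, if_false, add_zero]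
    rw [Fin.sum_univ_eq_sum_range (fun k => (if D.path e (k : ℝ) = q then C e else 0) +
      (if D.path e ((k + 1 : ℕ) : ℝ) = q then C e else 0)),
      sum_range_add_succ (fun k => if D.path e (k : ℝ) = q then C e else 0), Nat.cast_zero,
      D.path_zero, D.path_len]
  rw [Fintype.sum_prod_type, Fintype.sum_sigma]
  simp only [h]
  by_cases hq : ∃ v, D.point v = q
  · obtain ⟨v, rfl⟩ := hq
    refine Eq.trans (Finset.sum_congr rfl fun e _ => ?_) (hC v)
    have hne := D.tail_ne_head e
    simp only [D.point_injective.eq_iff, D.edge_eq e, Sym2.mem_iff]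
    by_cases h1 : D.tail e = v
    · subst h1
      simp [hne.symm]
    · by_cases h2 : D.head e = v
      · subst h2
        simp [hne]
      · simp [h1, h2, Ne.symm h1, Ne.symm h2]
  · refine Finset.sum_eq_zero fun e _ => ?_
    rw [if_neg fun h => hq ⟨_, h⟩, if_neg fun h => hq ⟨_, h⟩, add_zero]

/-- In a planar graph the darts at every vertex can be arranged cyclically so that every cycle with
coefficients in `ZMod 2` bounds. -/
theorem exists_next (D : PolygonalDrawing G) [Fintype G.edgeSet] :
    ∃ next : G.Dart → G.Dart, (∀ d, (next d).fst = d.fst) ∧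
      (∀ d e, e ≠ d → e.fst = d.fst → next d ≠ d) ∧
      ∀ C : G.edgeSet → ZMod 2,
        (∀ v, (∑ e : G.edgeSet, open Classical in if v ∈ e.1 then C e else 0) = 0) →
        ∃ I : G.Dart → ZMod 2, (∀ d, I d + I d.symm = C ⟨d.edge, d.edge_mem⟩) ∧
          ∀ d, I d = I (next d).symm := by
  classical
  obtain ⟨next, h1, h2, h3⟩ := exists_next_of_segments D.pieceTail D.pieceHead
    D.pieceTail_ne_pieceHead D.piece_meet
  have hex : ∀ d, ∃ d' : G.Dart, d'.fst = d.fst ∧ D.first d' = next (D.first d) := fun d =>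
    D.exists_first_eq _ _ ((h1 _).trans (D.chordStart_first d))
  choose nx hx1 hx2 using hex
  refine ⟨nx, hx1, fun d e hed he hd => ?_, fun C hC => ?_⟩
  · refine h2 (D.first d) (D.first e) (D.first_injective.ne hed) ?_ ?_
    · rw [chordStart_first, chordStart_first, he]
    · rw [← hx2, hd]
  · obtain ⟨T, hT1, hT2⟩ := h3 (fun x => C x.1) (D.sum_piece_eq_zero C hC)
    -- Only two pieces meet at a bend, so `next` swaps them there, and `T` is constant along the
    -- arc.
    have hstep : ∀ e k (hk : k + 1 < D.len e),
        T (⟨e, ⟨k + 1, hk⟩⟩, true) = T (⟨e, ⟨k, (Nat.lt_succ_self k).trans hk⟩⟩, true) := by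
      intro e k hk
      have hs1 : chordStart D.pieceTail D.pieceHead (⟨e, ⟨k + 1, hk⟩⟩, true) =
          D.path e ((k + 1 : ℕ) : ℝ) := by rw [chordStart_piece]; simp
      have hs2 : chordStart D.pieceTail D.pieceHead
          (⟨e, ⟨k, (Nat.lt_succ_self k).trans hk⟩⟩, false) = D.path e ((k + 1 : ℕ) : ℝ) := by
        rw [chordStart_piece]; simp
      have hn := h2 (⟨e, ⟨k + 1, hk⟩⟩, true) (⟨e, ⟨k, (Nat.lt_succ_self k).trans hk⟩⟩, false)
        (by simp) (hs2.trans hs1.symm)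
      have := (D.eq_of_chordStart_bend hk _ ((h1 _).trans hs1)).resolve_right hn
      rw [hT2, this]
      rfl
    have hconst : ∀ e k (hk : k < D.len e),
        T (⟨e, ⟨k, hk⟩⟩, true) = T (⟨e, ⟨0, D.len_pos e⟩⟩, true) := by
      intro e k
      induction k with
      | zero => exact fun _ => rfl
      | succ k ih => exact fun hk => (hstep e k hk).trans (ih _)
    have hsum : ∀ (d : G.Dart) (e : G.edgeSet), d.edge = e.1 → d.fst = D.tail e →
        d.snd = D.head e → T (D.first d) + T (D.first d.symm) = C e := by
      intro d e he h h'
      rw [D.first_of_fst_eq_tail he h,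
        D.first_of_fst_eq_head (d := d.symm) ((SimpleGraph.Dart.edge_symm d).trans he) h',
        ← hconst e (D.len e - 1) (Nat.sub_lt (D.len_pos e) one_pos)]
      exact hT1 ⟨e, _⟩ true
    have hI : ∀ d : G.Dart, T (D.first d) + T (D.first d.symm) = C ⟨d.edge, d.edge_mem⟩ := by
      intro d
      rcases D.fst_eq d with ⟨h, h'⟩ | ⟨h, h'⟩
      · exact hsum d _ rfl h h'
      · rw [add_comm]
        exact hsum d.symm ⟨d.edge, d.edge_mem⟩ (SimpleGraph.Dart.edge_symm d) h' h
    refine ⟨fun d => T (D.first d), hI, fun d => ?_⟩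
    have e1 := hI (nx d)
    have e2 := hT1 (D.first (nx d)).1 (D.first (nx d)).2
    rw [D.first_edge] at e2
    simp only
    rw [hT2 (D.first d), ← hx2]
    exact add_left_cancel (e2.trans e1.symm)

end PolygonalDrawing
end Drawing

/-! ### Cycle space, faces and the edge bound -/

section Counting

variable {V : Type*} {G : SimpleGraph V}

/-- Boundary of a one-dimensional chain of a graph with coefficients in `ZMod 2`. -/
noncomputable def edgeBoundary (G : SimpleGraph V) [Fintype G.edgeSet] :
    (G.edgeSet → ZMod 2) →+ (V → ZMod 2) where
  toFun C v := ∑ e : G.edgeSet, open Classical in if v ∈ e.1 then C e else 0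
  map_zero' := by ext; simp
  map_add' C C' := by
    ext v
    simp only [Pi.add_apply, ← Finset.sum_add_distrib]
    refine Finset.sum_congr rfl fun e _ => ?_
    split_ifs <;> simp

/-- The quotient by the kernel embeds in the functions on the vertices. -/
theorem two_pow_card_le_mul_card_ker [Fintype V] [Fintype G.edgeSet] :
    2 ^ Fintype.card G.edgeSet ≤ 2 ^ Fintype.card V * Nat.card (edgeBoundary G).ker := by
  classical
  have h := (edgeBoundary G).ker.card_eq_card_quotient_mul_card_addSubgroup
  have h1 : Nat.card (G.edgeSet → ZMod 2) = 2 ^ Fintype.card G.edgeSet := by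
    rw [Nat.card_eq_fintype_card, Fintype.card_fun, ZMod.card]
  have h2 : Nat.card (V → ZMod 2) = 2 ^ Fintype.card V := by
    rw [Nat.card_eq_fintype_card, Fintype.card_fun, ZMod.card]
  rw [← h1, h, ← h2]
  exact Nat.mul_le_mul_right _
    (Nat.card_le_card_of_injective _ (QuotientAddGroup.kerLift_injective (edgeBoundary G)))

/-- A bipartite planar graph, one side of which has no vertices of degree one, has at most twice as
many edges as vertices. -/
theorem SimpleGraph.IsPlanar.card_edgeSet_le [Fintype V] [Fintype G.edgeSet] (hG : G.IsPlanar)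
    (S : Set V) (hS : ∀ u v, G.Adj u v → (u ∈ S ↔ v ∉ S))
    (hdeg : ∀ d : G.Dart, d.fst ∈ S → ∃ e, e ≠ d ∧ e.fst = d.fst) :
    Fintype.card G.edgeSet ≤ 2 * Fintype.card V := by
  classical
  obtain ⟨D⟩ := hG.nonempty_polygonalDrawing
  obtain ⟨next, h1, h2, h3⟩ := D.exists_next
  set φ : G.Dart → G.Dart := fun d => (next d).symm with hφ
  have hφS : ∀ d, d.fst ∈ S ↔ (φ d).fst ∉ S := fun d => by
    rw [← h1 d]
    exact hS _ _ (next d).adj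
  -- A face of length two would make `next` fix both `d` and `d.symm`, so both ends of the edge
  -- would have degree one; but one of them is in `S`.
  have hφ2 : ∀ d, φ (φ d) ≠ d := by
    intro d hd
    have ha : (φ d).fst = d.snd := by
      have := congrArg (fun d : G.Dart => d.snd) hd
      simpa [hφ, h1] using this
    have hb : φ d = d.symm := by
      ext
      · exact ha
      · exact h1 d
    have hn1 : next d = d := by rw [← (next d).symm_symm]; exact (congrArg _ hb).trans d.symm_symm
    have hn2 : next d.symm = d.symm := by
      rw [← hb, ← (next (φ d)).symm_symm]
      exact (congrArg _ hd).trans hb.symm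
    by_cases hdS : d.fst ∈ S
    · obtain ⟨e, he, he'⟩ := hdeg d hdS
      exact h2 d e he he' hn1
    · obtain ⟨e, he, he'⟩ := hdeg d.symm (by
        by_contra h
        exact hdS ((hS _ _ d.adj).2 h))
      exact h2 d.symm e he he' hn2
  set F := Quot fun a b : G.Dart => b = φ a with hF
  have : Finite F := Finite.of_surjective (Quot.mk _) Quot.mk_surjective
  let _ : Fintype F := Fintype.ofFinite F
  have hmk : ∀ d, (Quot.mk _ (φ d) : F) = Quot.mk _ d := fun d =>
    (Quot.sound (r := fun a b : G.Dart => b = φ a) rfl).symm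
  -- `φ` switches sides, so darts an odd number of steps apart differ; those two steps apart differ
  -- by `hφ2`. Hence four distinct darts in each face.
  have hfib : ∀ q : F, 4 ≤ (Finset.univ.filter fun d : G.Dart => (Quot.mk _ d : F) = q).card := by
    intro q
    induction q using Quot.ind with
    | _ d =>
      have hne : ∀ a b : G.Dart, (a.fst ∈ S ↔ b.fst ∉ S) → a ≠ b := by
        rintro a b h rfl
        tauto
      have hc : ({d, φ d, φ (φ d), φ (φ (φ d))} : Finset G.Dart).card = 4 := by
        have e1 := hφS d
        have e2 := hφS (φ d)
        have e3 := hφS (φ (φ d))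
        rw [Finset.card_insert_of_notMem, Finset.card_insert_of_notMem,
          Finset.card_insert_of_notMem, Finset.card_singleton]
        · simpa using hne _ _ e3
        · simpa using ⟨hne _ _ e2, (hφ2 (φ d)).symm⟩
        · simpa using ⟨hne _ _ e1, (hφ2 d).symm, hne d (φ (φ (φ d))) (by tauto)⟩
      rw [← hc]
      refine Finset.card_le_card fun e he => ?_
      simp only [Finset.mem_insert, Finset.mem_singleton] at he
      rcases he with rfl | rfl | rfl | rfl <;> simp [hmk]
  have hcardF : 4 * Fintype.card F ≤ 2 * Fintype.card G.edgeSet := by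
    have hdart : Fintype.card G.Dart = 2 * Fintype.card G.edgeSet := by
      rw [G.dart_card_eq_twice_card_edges]
      convert rfl using 2
      convert (SimpleGraph.edgeFinset_card (G := G)).symm
    rw [← hdart, ← Finset.card_univ (α := G.Dart), Finset.card_eq_sum_card_fiberwise
      (f := fun d => (Quot.mk _ d : F)) (t := Finset.univ) (fun _ _ => Finset.mem_coe.2
        (Finset.mem_univ _)), ← Finset.card_univ, mul_comm, ← smul_eq_mul]
    exact Finset.card_nsmul_le_sum _ _ _ fun q _ => hfib q
  -- A cycle is recovered from its potential `I`, and `I` is constant on faces.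
  have hker : Nat.card (edgeBoundary G).ker ≤ 2 ^ Fintype.card F := by
    have hex : ∀ C : (edgeBoundary G).ker, ∃ I : G.Dart → ZMod 2,
        (∀ d, I d + I d.symm = C.1 ⟨d.edge, d.edge_mem⟩) ∧ ∀ d, I d = I (next d).symm :=
      fun C => h3 C.1 fun v => congrFun C.2 v
    choose I hI1 hI2 using hex
    let J : (edgeBoundary G).ker → F → ZMod 2 := fun C => Quot.lift (I C) (by
      rintro a b rfl
      exact hI2 C a)
    have hJ : Function.Injective J := by
      intro C C' h
      have hI : ∀ d, I C d = I C' d := fun d => congrFun h (Quot.mk _ d)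
      refine Subtype.ext (funext fun e => ?_)
      obtain ⟨e, he⟩ := e
      induction e with
      | _ u v =>
        have h1 := hI1 C ⟨(u, v), he⟩
        rw [hI, hI, hI1 C'] at h1
        exact h1.symm
    refine (Nat.card_le_card_of_injective J hJ).trans_eq ?_
    rw [Nat.card_eq_fintype_card, Fintype.card_fun, ZMod.card]
  have hpow : 2 ^ Fintype.card G.edgeSet ≤ 2 ^ (Fintype.card V + Fintype.card F) := by
    rw [pow_add]
    exact two_pow_card_le_mul_card_ker.trans (Nat.mul_le_mul_left _ hker)
  have := (Nat.pow_le_pow_iff_right one_lt_two).1 hpow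
  omega

theorem SimpleGraph.IsPlanar.mono {H : SimpleGraph V} (hG : G.IsPlanar) (h : H ≤ G) :
    H.IsPlanar := by
  obtain ⟨p, arc, h1, h2, h3, h4⟩ := hG
  have he : H.edgeSet ⊆ G.edgeSet := SimpleGraph.edgeSet_mono h
  exact ⟨p, arc, h1, fun u v huv => h2 u v (h huv), fun e hm => h3 e (he hm),
    fun e hm f hf => h4 e (he hm) f (he hf)⟩

end Counting

/-! ### Broken graphs that are trees -/

section Tree

variable {V : Type*} {G : SimpleGraph V} {S : Set V}

theorem SimpleGraph.eq_of_brokenEnd_eq {d x : G.Dart} (hx : x.fst ∈ S)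
    (h : G.brokenEnd S d = Sum.inr ⟨x, hx⟩) : d = x := by
  unfold SimpleGraph.brokenEnd at h
  split_ifs at h
  exact congrArg Subtype.val (Sum.inr.inj h)

theorem SimpleGraph.brokenEnd_of_mem {d : G.Dart} (h : d.fst ∈ S) :
    G.brokenEnd S d = Sum.inr ⟨d, h⟩ := dif_pos h

theorem SimpleGraph.brokenEnd_of_notMem {d : G.Dart} (h : d.fst ∉ S) :
    G.brokenEnd S d = Sum.inl ⟨d.fst, h⟩ := dif_neg h

/-- Breaking vertices does not change the edges of a graph. -/
noncomputable def SimpleGraph.dartEquivBreakVertices (G : SimpleGraph V) (S : Set V) :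
    G.Dart ≃ (G.breakVertices S).Dart :=
  Equiv.ofBijective (fun d => ⟨(G.brokenEnd S d, G.brokenEnd S d.symm), d, rfl, rfl⟩) (by
    constructor
    · intro d e h
      have h1 : G.brokenEnd S d = G.brokenEnd S e := congrArg (fun d => d.fst) h
      have h2 : G.brokenEnd S d.symm = G.brokenEnd S e.symm := congrArg (fun d => d.snd) h
      -- A broken end names its dart. If neither dart has a broken end, both ends are original
      -- vertices and determine the dart.
      by_cases he : e.fst ∈ S
      · exact eq_of_brokenEnd_eq he (h1.trans (brokenEnd_of_mem he))
      by_cases he' : e.snd ∈ S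
      · have := eq_of_brokenEnd_eq (x := e.symm) he' (h2.trans (brokenEnd_of_mem he'))
        rw [← d.symm_symm, this, e.symm_symm]
      by_cases hd : d.fst ∈ S
      · exact (eq_of_brokenEnd_eq hd (h1.symm.trans (brokenEnd_of_mem hd))).symm
      by_cases hd' : d.snd ∈ S
      · have := eq_of_brokenEnd_eq (x := d.symm) hd' (h2.symm.trans (brokenEnd_of_mem hd'))
        rw [← e.symm_symm, this, d.symm_symm]
      rw [brokenEnd_of_notMem hd, brokenEnd_of_notMem he] at h1
      rw [brokenEnd_of_notMem (d := d.symm) hd', brokenEnd_of_notMem (d := e.symm) he'] at h2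
      ext
      · exact congrArg Subtype.val (Sum.inl.inj h1)
      · exact congrArg Subtype.val (Sum.inl.inj h2)
    · rintro ⟨⟨x, y⟩, d, hx, hy⟩
      exact ⟨d, by ext <;> assumption⟩)

/-- If breaking `S` leaves a connected graph, then no two vertices of `S` are adjacent, unless the
graph is a single edge. -/
theorem SimpleGraph.snd_notMem_of_connected_breakVertices (h : (G.breakVertices S).Connected)
    {d e : G.Dart} (hd : d.fst ∈ S) (hed : e ≠ d) (he : e.fst = d.fst) : d.snd ∉ S := by
  intro hd'
  -- If both ends of `d` are broken, its two new vertices form a whole component, which misses the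
  -- new vertex of `e`.
  have hclosed : ∀ x y, (G.breakVertices S).Walk x y →
      (x = Sum.inr ⟨d, hd⟩ ∨ x = Sum.inr ⟨d.symm, hd'⟩) →
      (y = Sum.inr ⟨d, hd⟩ ∨ y = Sum.inr ⟨d.symm, hd'⟩) := by
    intro x y w
    induction w with
    | nil => exact id
    | cons hadj _ ih =>
      intro hx
      refine ih ?_
      obtain ⟨f, hf, rfl⟩ := hadj
      rcases hx with rfl | rfl
      · obtain rfl := eq_of_brokenEnd_eq _ hf
        exact Or.inr (brokenEnd_of_mem hd')
      · obtain rfl := eq_of_brokenEnd_eq _ hf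
        exact Or.inl (brokenEnd_of_mem (d := d.symm.symm) hd)
  obtain ⟨w⟩ := h.preconnected (Sum.inr ⟨d, hd⟩) (Sum.inr ⟨e, he ▸ hd⟩)
  rcases hclosed _ _ w (Or.inl rfl) with h | h
  · exact hed (congrArg Subtype.val (Sum.inr.inj h))
  · have : e = d.symm := congrArg Subtype.val (Sum.inr.inj h)
    rw [this] at he
    exact d.snd_ne_fst he

theorem SimpleGraph.mul_card_le_card_dart [Fintype V] [DecidableRel G.Adj] (P : V → Prop)
    [DecidablePred P] (k : ℕ) (h : ∀ v, P v → k ≤ G.degree v) :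
    k * Fintype.card {v // P v} ≤ Fintype.card {d : G.Dart // P d.fst} := by
  classical
  rw [Fintype.card_subtype, Fintype.card_subtype, Finset.card_eq_sum_card_fiberwise
    (f := fun d : G.Dart => d.fst) (s := Finset.univ.filter fun d : G.Dart => P d.fst)
    (t := Finset.univ.filter P) (fun d hd => by simpa using hd), mul_comm, ← smul_eq_mul]
  refine Finset.card_nsmul_le_sum _ _ _ fun v hv => ?_
  have hv : P v := by simpa using hv
  rw [Finset.filter_filter]
  refine (h v hv).trans ?_
  rw [← G.dart_fst_fiber_card_eq_degree v]
  refine Finset.card_le_card fun d hd => ?_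
  simp only [Finset.mem_filter, Finset.mem_univ, true_and] at hd ⊢
  exact ⟨hd ▸ hv, hd⟩

/-- Breaking vertices of degree at least six in a planar graph, all other vertices of which have
degree at least five, never yields a tree. -/
theorem SimpleGraph.IsPlanar.not_isTree_breakVertices [Finite V] (hG : G.IsPlanar)
    (h6 : ∀ v ∈ S, 6 ≤ (G.neighborSet v).ncard) (h5 : ∀ v ∉ S, 5 ≤ (G.neighborSet v).ncard) :
    ¬ (G.breakVertices S).IsTree := by
  classical
  intro hT
  have := Fintype.ofFinite V
  have hdeg : ∀ v, (G.neighborSet v).ncard = G.degree v := fun v => by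
    rw [← G.card_neighborSet_eq_degree, Set.ncard_eq_toFinset_card', Set.toFinset_card]
  have hother : ∀ d : G.Dart, d.fst ∈ S → ∃ e : G.Dart, e ≠ d ∧ e.fst = d.fst := by
    intro d hd
    obtain ⟨w, hw, hne⟩ := Set.exists_ne_of_one_lt_ncard
      (show 1 < (G.neighborSet d.fst).ncard by have := h6 _ hd; omega) d.snd
    refine ⟨⟨(d.fst, w), hw⟩, fun h => hne ?_, rfl⟩
    rw [← h]
  have hind : ∀ d : G.Dart, d.fst ∈ S → d.snd ∉ S := fun d hd => by
    obtain ⟨e, he, he'⟩ := hother d hd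
    exact snd_notMem_of_connected_breakVertices hT.connected hd he he'
  have hedge : (G.breakVertices S).edgeFinset.card = G.edgeFinset.card := by
    have h1 := G.dart_card_eq_twice_card_edges
    have h2 := (G.breakVertices S).dart_card_eq_twice_card_edges
    have h3 := Fintype.card_congr (G.dartEquivBreakVertices S)
    omega
  have htree := hT.card_edgeFinset
  rw [hedge, Fintype.card_sum] at htree
  have hsplit : Fintype.card {d : G.Dart // d.fst ∈ S} + Fintype.card {d : G.Dart // d.fst ∉ S} =
      2 * G.edgeFinset.card := by
    rw [← G.dart_card_eq_twice_card_edges, Fintype.card_subtype_compl]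
    exact Nat.add_sub_of_le (Fintype.card_subtype_le _)
  have hV : Fintype.card {v // v ∈ S} + Fintype.card {v // v ∉ S} = Fintype.card V := by
    rw [Fintype.card_subtype_compl]
    exact Nat.add_sub_of_le (Fintype.card_subtype_le _)
  have hS6 := G.mul_card_le_card_dart (· ∈ S) 6 fun v hv => hdeg v ▸ h6 v hv
  have hU5 := G.mul_card_le_card_dart (· ∉ S) 5 fun v hv => hdeg v ▸ h5 v hv
  let H : SimpleGraph V :=
    { Adj := fun u v => G.Adj u v ∧ (u ∈ S ↔ v ∉ S)
      symm := ⟨fun u v h => ⟨h.1.symm, by tauto⟩⟩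
      loopless := ⟨fun u h => G.loopless.irrefl u h.1⟩ }
  have hH : Fintype.card H.edgeSet ≤ 2 * Fintype.card V := by
    refine SimpleGraph.IsPlanar.card_edgeSet_le (hG.mono fun u v h => h.1) S
      (fun u v h => h.2) fun d hd => ?_
    obtain ⟨e, he, he'⟩ := hother ⟨d.toProd, d.adj.1⟩ hd
    refine ⟨⟨e.toProd, e.adj, ?_⟩, fun h => he ?_, he'⟩
    · have h1 : e.fst ∈ S := he' ▸ hd
      exact ⟨fun _ => hind e h1, fun _ => h1⟩
    · ext1
      exact congrArg (fun d : H.Dart => d.toProd) h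
  have hinj : Fintype.card {d : G.Dart // d.fst ∈ S} ≤ Fintype.card H.edgeSet := by
    refine Fintype.card_le_of_injective
      (fun d => ⟨d.1.edge, d.1.adj, fun _ => hind d.1 d.2, fun _ => d.2⟩) fun d e h => ?_
    have h' : d.1.edge = e.1.edge := congrArg Subtype.val h
    rcases SimpleGraph.dart_edge_eq_iff d.1 e.1 |>.1 h' with h | h
    · exact Subtype.ext h
    · have := d.2
      rw [h] at this
      exact absurd this (hind e.1 e.2)
  -- With `D`, `D'` the dart counts inside and outside `S`: `D ≤ 2(s + u)` and `6s ≤ D` give `D ≤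
  -- 3u`; the tree equation then gives `D' + 2 ≤ 5u ≤ D'`.
  omega

theorem MarkedGraph.IsPlanarGraphInput.not_hasTreeResidue [Finite V] {B U : Set ℕ}
    (hB : ∀ b ∈ B, 5 < b) (hU : ∀ u ∈ U, 4 < u) {I : MarkedGraph V}
    (hI : I.IsPlanarGraphInput B U) : ¬ I.HasTreeResidue := by
  rintro ⟨S, hS, hT⟩
  refine hI.1.not_isTree_breakVertices (fun v hv => hB _ (hI.2.1 v (hS hv))) (fun v _ => ?_) hT
  by_cases hv : v ∈ I.breakable
  · exact (Nat.lt_succ_self 4).trans (hB _ (hI.2.1 v hv))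
  · exact hU _ (hI.2.2 v hv)

end Tree

/-! ### A machine for the empty language -/

/-- A machine that empties its stack and then writes `false`. -/
def rejectMachine : Turing.FinTM2 where
  K := Unit
  k₀ := ()
  k₁ := ()
  Γ _ := Bool
  Λ := Unit
  main := ()
  σ := Bool
  initialState := false
  Γk₀Fin := inferInstanceAs (Fintype Bool)
  -- The internal bit records whether the stack was empty. It is reset before halting because
  -- `Turing.haltList` demands the initial state.
  m _ := .pop () (fun _ o => o.isNone)
    (.branch id (.push () (fun _ => false) (.load (fun _ => false) .halt)) (.goto fun _ => ()))

/-- Popping a bit leaves an initial configuration on the shorter word, so the run takes one step per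
bit and one more to write the answer. -/
theorem rejectMachine_step_cons (b : Bool) (w : List Bool) :
    rejectMachine.step (Turing.initList rejectMachine (b :: w)) =
      some (Turing.initList rejectMachine w) := by
  refine congrArg some ?_
  refine congrArg (Turing.TM2.Cfg.mk (some ()) false) ?_
  funext k
  cases k
  rfl

theorem rejectMachine_step_nil :
    rejectMachine.step (Turing.initList rejectMachine []) =
      some (Turing.haltList rejectMachine [false]) := by
  refine congrArg some ?_
  refine congrArg (Turing.TM2.Cfg.mk none false) ?_
  funext k
  cases k
  rfl

theorem rejectMachine_iterate (w : List Bool) :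
    (flip bind rejectMachine.step)^[w.length + 1] (some (Turing.initList rejectMachine w)) =
      some (Turing.haltList rejectMachine [false]) := by
  induction w with
  | nil => exact rejectMachine_step_nil
  | cons b w ih =>
    rw [List.length_cons, Function.iterate_succ_apply, ← ih]
    exact congrArg _ (rejectMachine_step_cons b w)

theorem Language.inP_of_forall_notMem {L : Language Bool} (h : ∀ w, w ∉ L) : L.InP :=
  ⟨{ tm := rejectMachine
     inputAlphabet := Equiv.refl Bool
     outputAlphabet := Equiv.refl Bool
     time := Polynomial.X + 1
     outputsFun := fun w =>
      { steps := w.length + 1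
        evals_in_steps := by
          have hw : w.map (Equiv.refl Bool).invFun = w := List.map_id w
          simp only [h w, decide_false]
          refine (congrArg (fun v => (flip bind rejectMachine.step)^[w.length + 1]
            (some (Turing.initList rejectMachine v))) hw).trans ?_
          exact rejectMachine_iterate w
        steps_le_m := by simp } }⟩

theorem mainTheorem4 (B U : Set ℕ) (hB : ∀ b ∈ B, 5 < b) (hU : ∀ u ∈ U, 4 < u) :
    (∀ {V : Type*} [Finite V] (I : MarkedGraph V),
      I.IsPlanarGraphInput B U → ¬ I.HasTreeResidue) ∧
    (planarGraphTRVB B U).InP := by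
  refine ⟨fun I hI => hI.not_hasTreeResidue hB hU, Language.inP_of_forall_notMem ?_⟩
  rintro w ⟨n, I, -, hI, hT⟩
  exact hI.not_hasTreeResidue hB hU hT
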